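/- All groups are abelian. A group $C$ is cotorsion if every extension of $C$ by a torsion-free abelian group splits (that is, every short exact sequence of abelian groups $0\to C\to E\to F\to 0$ with $F$ torsion-free splits). A group $G$ is co-Hopfian if every injective endomorphism of $G$ is an automorphism. For a prime $p$, $\mathbb{Z}(p^\infty)$ denotes the $p$-primary component of $\mathbb{Q}/\mathbb{Z}$. Corollary 5.5. Let $G$ be an abelian group whose torsion subgroup $tG$ is cotorsion. Then $G$ is co-Hopfian if and only if there are an integer $n\ge 0$, an integer $n_p\ge 0$ for each prime $p$, and a finite abelian group $B$ such that $$G\;\cong\;\mathbb{Q}^n\;\oplus\;\bigoplus_{p\text{ prime}}\mathbb{Z}(p^\infty)^{n_p}\;\oplus\;B.$$ -/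

import Mathlib

open scoped DirectSum

universe u

/-- An abelian group is co-Hopfian if every injective endomorphism is an automorphism. -/
def IsCoHopfian (G : Type*) [AddCommGroup G] : Prop :=
  ∀ f : G →+ G, Function.Injective f → Function.Bijective f

/-- An abelian group `C` is cotorsion if every extension `0 → C → E → F → 0` of abelian groups
with `F` torsion-free splits. The groups `E` and `F` range over the universe of `C`; larger
universes would give the same notion, because the extensions of `C` by `ℚ` already decide it. -/
def IsCotorsion (C : Type u) [AddCommGroup C] : Prop :=
  ∀ (E F : Type u) [AddCommGroup E] [AddCommGroup F] [IsAddTorsionFree F]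
    (S : AddGroupExtension C E F), Nonempty S.Splitting

/-- The quasi-cyclic group `ℤ(p^∞)`: the elements of `ℚ/ℤ` killed by some power of `p`. -/
abbrev QuasiCyclic (p : ℕ) : Type :=
  AddCommGroup.primaryComponent (AddCircle (1 : ℚ)) p

/-! Since `G/tG` is torsion-free, cotorsion of `tG` splits `G` as `tG ⊕ F`, and direct summands of
co-Hopfian groups are co-Hopfian. On `F` multiplication by `n ≠ 0` is injective, hence onto, so `F`
is a rational vector space; an infinite basis would allow a non-surjective shift.

The crux is that a torsion cotorsion group `T` has `M • T` divisible for some `M ≠ 0`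
(`IsCotorsion.exists_nsmul_divisible`): otherwise a diagonal construction yields an element of
infinite order. Hence `T` is divisible plus bounded. The bounded part is finite
(`IsCoHopfian.finite_of_exponent_ne_zero`), and the divisible part is a sum of quasi-cyclic groups,
each with finite multiplicity.

Conversely, an injective endomorphism permutes each finite `m`-torsion subgroup and induces an
injective, hence bijective, linear map on `ℚ^n`. -/

theorem IsCoHopfian.of_addEquiv {G H : Type*} [AddCommGroup G] [AddCommGroup H] (e : G ≃+ H)
    (hG : IsCoHopfian G) : IsCoHopfian H := by
  intro f hf
  have h := hG ((e.symm.toAddMonoidHom.comp f).comp e.toAddMonoidHom)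
    (e.symm.injective.comp (hf.comp e.injective))
  refine ⟨hf, fun y => ?_⟩
  obtain ⟨x, hx⟩ := h.2 (e.symm y)
  exact ⟨e x, e.symm.injective hx⟩

theorem IsCoHopfian.fst {A B : Type*} [AddCommGroup A] [AddCommGroup B]
    (h : IsCoHopfian (A × B)) : IsCoHopfian A := by
  intro f hf
  have h := h (f.prodMap (AddMonoidHom.id B)) (Function.Injective.prodMap hf fun _ _ h => h)
  refine ⟨hf, fun y => ?_⟩
  obtain ⟨x, hx⟩ := h.2 (y, 0)
  exact ⟨x.1, congrArg Prod.fst hx⟩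

theorem IsCoHopfian.snd {A B : Type*} [AddCommGroup A] [AddCommGroup B]
    (h : IsCoHopfian (A × B)) : IsCoHopfian B :=
  (h.of_addEquiv (AddEquiv.prodComm (M := A) (N := B))).fst

/-- An infinite index set injects into itself missing a point; reindexing along that map is
injective but not onto. -/
theorem IsCoHopfian.finite_of_finsupp {ι A : Type*} [AddCommGroup A] [Nontrivial A]
    (h : IsCoHopfian (ι →₀ A)) : Finite ι := by
  by_contra hι
  rw [not_finite_iff_infinite] at hι
  obtain ⟨g, hg, hg'⟩ : ∃ g : ι → ι, Function.Injective g ∧ ¬ Function.Surjective g := by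
    let i₀ : ι := Classical.arbitrary ι
    obtain ⟨e⟩ := Cardinal.eq.1 (Cardinal.mk_compl_of_infinite ({i₀} : Set ι)
      (by simpa using Cardinal.one_lt_aleph0.trans_le (Cardinal.aleph0_le_mk ι))).symm
    refine ⟨fun i => e i, Subtype.val_injective.comp e.injective, fun hs => ?_⟩
    obtain ⟨j, hj⟩ := hs i₀
    exact (e j).2 hj
  obtain ⟨a, ha⟩ := exists_ne (0 : A)
  have hb := h (Finsupp.mapDomain.addMonoidHom g) (Finsupp.mapDomain_injective hg)
  refine hg' fun i => ?_
  obtain ⟨x, hx⟩ := hb.2 (Finsupp.single i a)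
  by_contra! hi
  have h1 : Finsupp.mapDomain g x i = 0 :=
    Finsupp.mapDomain_of_notMem_range _ i (by rintro ⟨j, hj⟩; exact hi j hj)
  have h2 : Finsupp.mapDomain g x = Finsupp.single i a := hx
  rw [h2, Finsupp.single_eq_same] at h1
  exact ha h1

/-! ### Splittings and retractions -/

/-- A retraction of a subgroup splits the group as a product. -/
noncomputable def AddEquiv.prodKerOfLeftInverse {A G : Type*} [AddCommGroup A] [AddCommGroup G]
    (i : A →+ G) (r : G →+ A) (h : Function.LeftInverse r i) : G ≃+ A × r.ker where
  toFun g := (r g, ⟨g - i (r g), by simp [AddMonoidHom.mem_ker, h (r g)]⟩)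
  invFun x := i x.1 + x.2
  left_inv g := by simp
  right_inv x := by
    have hx : r (x.2 : G) = 0 := x.2.2
    ext <;> simp [h x.1, hx]
  map_add' x y := by
    ext
    · simp
    · simp; abel

/-- Condition `hF` says exactly that the quotient by `i.range` is torsion-free. Subtracting the
section from the identity of `E` then gives the retraction. -/
theorem IsCotorsion.exists_leftInverse {C E : Type u} [AddCommGroup C] [AddCommGroup E]
    (hC : IsCotorsion C) (i : C →+ E) (hi : Function.Injective i)
    (hF : ∀ (n : ℕ) (e : E), n ≠ 0 → n • e ∈ i.range → e ∈ i.range) :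
    ∃ r : E →+ C, Function.LeftInverse r i := by
  have : IsAddTorsionFree (E ⧸ i.range) := by
    refine ⟨fun n hn => (injective_iff_map_eq_zero (nsmulAddMonoidHom (α := E ⧸ i.range) n)).2 ?_⟩
    intro x hx
    induction x using QuotientAddGroup.induction_on with
    | H e =>
      rw [QuotientAddGroup.eq_zero_iff]
      refine hF n e hn ?_
      rw [← QuotientAddGroup.eq_zero_iff]
      exact hx
  let S : AddGroupExtension C E (E ⧸ i.range) :=
    { inl := i
      rightHom := QuotientAddGroup.mk' i.range
      inl_injective := hi
      range_inl_eq_ker_rightHom := (QuotientAddGroup.ker_mk' _).symm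
      rightHom_surjective := QuotientAddGroup.mk'_surjective _ }
  obtain ⟨s⟩ := hC E (E ⧸ i.range) S
  have hs : ∀ x, S.rightHom (s x) = x := fun x => s.rightHom_splitting x
  let e : C ≃+ i.range := AddMonoidHom.ofInjective hi
  let q : E →+ i.range :=
    { toFun x := ⟨x - s (S.rightHom x), by
        have : x - s (S.rightHom x) ∈ S.rightHom.ker := by
          rw [AddMonoidHom.mem_ker, map_sub, hs, sub_self]
        rwa [← S.range_inl_eq_ker_rightHom] at this⟩
      map_zero' := by ext; simp
      map_add' x y := by ext; simp [map_add]; abel }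
  refine ⟨e.symm.toAddMonoidHom.comp q, fun c => ?_⟩
  change e.symm (q (i c)) = c
  rw [AddEquiv.symm_apply_eq]
  ext
  have : S.rightHom (i c) = 0 := S.rightHom_inl c
  simp only [q, e, AddMonoidHom.coe_mk, ZeroHom.coe_mk, this, map_zero, sub_zero]
  exact (AddMonoidHom.ofInjective_apply hi).symm

/-! ### Linear systems over cotorsion groups, and bounded quotients -/

/-- The endomorphism `single n 1 ↦ single n 1 - m n • single (n + 1) 1` of the free abelian group
on `ℕ`, whose cokernel is the colimit of the system of multiplications by `m n` on `ℤ`. -/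
noncomputable def telescopeMap (m : ℕ → ℕ) : (ℕ →₀ ℤ) →+ (ℕ →₀ ℤ) :=
  Finsupp.liftAddHom fun n =>
    Finsupp.singleAddHom n - (m n) • Finsupp.singleAddHom (n + 1)

theorem telescopeMap_single (m : ℕ → ℕ) (n : ℕ) (z : ℤ) :
    telescopeMap m (Finsupp.single n z) =
      Finsupp.single n z - m n • Finsupp.single (n + 1) z := by
  simp [telescopeMap]

theorem telescopeMap_apply_zero (m : ℕ → ℕ) (q : ℕ →₀ ℤ) : telescopeMap m q 0 = q 0 := by
  induction q using Finsupp.induction_linear with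
  | zero => simp
  | add f g hf hg => simp [hf, hg]
  | single n z => simp [telescopeMap_single]

theorem telescopeMap_apply_succ (m : ℕ → ℕ) (q : ℕ →₀ ℤ) (n : ℕ) :
    telescopeMap m q (n + 1) = q (n + 1) - m n * q n := by
  induction q using Finsupp.induction_linear with
  | zero => simp
  | add f g hf hg => simp [hf, hg]; ring
  | single k z =>
    rcases eq_or_ne k n with rfl | h
    · simp [telescopeMap_single]
    · simp [telescopeMap_single, h, Finsupp.single_apply]

theorem telescopeMap_injective (m : ℕ → ℕ) : Function.Injective (telescopeMap m) := by
  refine (injective_iff_map_eq_zero _).2 fun q hq => ?_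
  ext n
  induction n with
  | zero => rw [← telescopeMap_apply_zero m, hq]
  | succ n ih =>
    have := telescopeMap_apply_succ m q n
    rw [hq, ih] at this
    simpa using this.symm

/-- The cokernel is torsion-free: the map is unitriangular, so divisibility by `N` passes from
coordinate to coordinate of `q`. -/
theorem mem_range_telescopeMap_of_nsmul (m : ℕ → ℕ) {N : ℕ} (hN : N ≠ 0) (p : ℕ →₀ ℤ)
    (q : ℕ →₀ ℤ) (h : N • p = telescopeMap m q) : ∃ q', p = telescopeMap m q' := by
  have hdvd : ∀ n, (N : ℤ) ∣ q n := by
    intro n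
    induction n with
    | zero => rw [← telescopeMap_apply_zero m, ← h]; simp
    | succ n ih =>
      have := telescopeMap_apply_succ m q n
      rw [← h] at this
      rw [eq_add_of_sub_eq this.symm]
      exact dvd_add (by simp) (ih.mul_left _)
  have hq : q = N • q.mapRange (· / (N : ℤ)) (by simp) := by
    ext n
    simp [Int.mul_ediv_cancel' (hdvd n)]
  rw [hq, map_nsmul] at h
  exact ⟨_, nsmul_right_injective hN h⟩

/-- Pushing the telescope extension out along `single n 1 ↦ a n` imposes these equations on the
classes of the basis vectors. A retraction onto `T` carries those classes to a solution. -/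
theorem IsCotorsion.exists_sub_eq {T : Type u} [AddCommGroup T] (hT : IsCotorsion T)
    (m : ℕ → ℕ) (a : ℕ → T) : ∃ x : ℕ → T, ∀ n, x n - m n • x (n + 1) = a n := by
  let φ : (ℕ →₀ ℤ) →+ T := Finsupp.liftAddHom fun n => (zmultiplesHom T) (a n)
  let K : AddSubgroup (T × (ℕ →₀ ℤ)) := ((-φ).prod (telescopeMap m)).range
  let i : T →+ (T × (ℕ →₀ ℤ)) ⧸ K := (QuotientAddGroup.mk' K).comp (AddMonoidHom.inl _ _)
  have hi : Function.Injective i := by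
    refine (injective_iff_map_eq_zero _).2 fun t ht => ?_
    obtain ⟨q, hq⟩ := (QuotientAddGroup.eq_zero_iff _).1 ht
    have h2 : telescopeMap m q = 0 := congrArg Prod.snd hq
    have h1 : -φ q = t := congrArg Prod.fst hq
    rw [← h1, (injective_iff_map_eq_zero _).1 (telescopeMap_injective m) q h2]
    simp
  obtain ⟨r, hr⟩ := hT.exists_leftInverse i hi (by
    intro N e hN he
    obtain ⟨⟨t, p⟩, rfl⟩ := QuotientAddGroup.mk'_surjective K e
    obtain ⟨t', ht'⟩ := he
    have : -((t', 0) : T × (ℕ →₀ ℤ)) + N • (t, p) ∈ K := QuotientAddGroup.eq.1 ht'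
    obtain ⟨q, hq⟩ := this
    have h2 : telescopeMap m q = N • p := by simpa using congrArg Prod.snd hq
    obtain ⟨q', hp⟩ := mem_range_telescopeMap_of_nsmul m hN p q h2.symm
    refine ⟨t + φ q', QuotientAddGroup.eq.2 ⟨q', ?_⟩⟩
    ext : 1
    · simp
    · simp [hp])
  refine ⟨fun n => r (QuotientAddGroup.mk' K (0, Finsupp.single n 1)), fun n => ?_⟩
  rw [← map_nsmul, ← map_nsmul, ← map_sub, ← map_sub]
  rw [← hr (a n)]
  congr 1
  refine QuotientAddGroup.eq.2 ⟨-Finsupp.single n 1, ?_⟩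
  ext : 1
  · have hφ : φ (Finsupp.single n 1) = a n := by simp [φ]
    simp [hφ]
  · simp only [AddMonoidHom.prod_apply, map_neg, telescopeMap_single]
    simp

theorem IsCotorsion.exists_nsmul_divisible {T : Type u} [AddCommGroup T] (hT : IsCotorsion T)
    (htor : IsAddTorsion T) :
    ∃ M : ℕ, M ≠ 0 ∧ ∀ q : ℕ, q ≠ 0 → ∀ x : T, ∃ y : T, M • x = (q * M) • y := by
  by_contra! H
  choose! q hq0 b hb using H
  -- `N k` is the product of the first `k` multipliers
  let N : ℕ → ℕ := fun k => Nat.rec 1 (fun k Nk => Nk * q ((k + 1) * Nk)) k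
  have hNs : ∀ k, N (k + 1) = N k * q ((k + 1) * N k) := fun k => rfl
  have hN : ∀ k, N k ≠ 0 := by
    intro k
    induction k with
    | zero => exact one_ne_zero
    | succ k ih => rw [hNs]; exact mul_ne_zero ih (hq0 _ (mul_ne_zero (Nat.succ_ne_zero k) ih))
  -- Diagonal step: `a` is `0` or `b ((k + 1) * N k)`, chosen so that the next partial sum, times `k
  -- + 1`, avoids `(k + 1) * N (k + 1) • T`.
  have key : ∀ k (s : T), ∃ a : T, ∀ y : T,
      (k + 1) • (s + N k • a) ≠ ((k + 1) * N (k + 1)) • y := by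
    intro k s
    have hM : (k + 1) * N k ≠ 0 := mul_ne_zero (Nat.succ_ne_zero k) (hN k)
    by_cases h : ∃ y : T, (k + 1) • s = ((k + 1) * N (k + 1)) • y
    · obtain ⟨y₀, hy₀⟩ := h
      refine ⟨b ((k + 1) * N k), fun y hy => hb _ hM (y - y₀) ?_⟩
      rw [smul_add, hy₀, smul_smul] at hy
      rw [eq_sub_of_add_eq' hy, hNs, smul_sub]
      congr 2 <;> ring
    · push Not at h
      exact ⟨0, by simpa using h⟩
  choose a ha using key
  let s : ℕ → T := fun k => Nat.rec 0 (fun k s => s + N k • a k s) k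
  have hs : ∀ k, s (k + 1) = s k + N k • a k (s k) := fun k => rfl
  obtain ⟨x, hx⟩ := hT.exists_sub_eq (fun k => q ((k + 1) * N k)) (fun k => a k (s k))
  have hsum : ∀ k, x 0 = s k + N k • x k := by
    intro k
    induction k with
    | zero => simp [s, N]
    | succ k ih =>
      rw [ih, hs, hNs, ← hx k, add_assoc, smul_sub, smul_smul]
      simp
  obtain ⟨n, hn, hn0⟩ := isOfFinAddOrder_iff_nsmul_eq_zero.1 (htor (x 0))
  -- If `k + 1` kills `x 0`, then `hsum (k + 1)` contradicts the choice made at stage `k`.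
  obtain ⟨k, rfl⟩ := Nat.exists_eq_succ_of_ne_zero hn.ne'
  refine ha k (s k) (-x (k + 1)) ?_
  have h1 := hsum (k + 1)
  rw [hs] at h1
  rw [eq_sub_of_add_eq h1.symm, smul_sub, hn0, smul_neg, mul_smul (k + 1), zero_sub]

/-! ### Bounded groups -/

/-- With `d = gcd(c, n)`, the class of `n / d` kills `c`, hence `y`, so `d` divides `y`; Bézout
makes `d` a multiple of `c`. -/
theorem ZMod.exists_mul_eq_of_annihilator {n : ℕ} [NeZero n] (c y : ZMod n)
    (h : ∀ z : ZMod n, z * c = 0 → z * y = 0) : ∃ w, w * c = y := by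
  have hn : n ≠ 0 := NeZero.ne n
  set d := Nat.gcd c.val n with hd
  have hdn : d ∣ n := Nat.gcd_dvd_right _ _
  have hdc : d ∣ c.val := Nat.gcd_dvd_left _ _
  have hd0 : 0 < d := Nat.pos_of_dvd_of_pos hdn (Nat.pos_of_ne_zero hn)
  have h1 : ((n / d : ℕ) : ZMod n) * c = 0 := by
    obtain ⟨k, hk⟩ := hdc
    rw [← ZMod.natCast_zmod_val c, ← Nat.cast_mul, ZMod.natCast_eq_zero_iff, hk, ← mul_assoc,
      Nat.div_mul_cancel hdn]
    exact dvd_mul_right _ _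
  have h2 := h _ h1
  rw [← ZMod.natCast_zmod_val y, ← Nat.cast_mul, ZMod.natCast_eq_zero_iff] at h2
  have h3 : d ∣ y.val := by
    have : n / d * d ∣ n / d * y.val := by rwa [Nat.div_mul_cancel hdn]
    exact Nat.dvd_of_mul_dvd_mul_left (Nat.div_pos (Nat.le_of_dvd (Nat.pos_of_ne_zero hn) hdn) hd0) this
  obtain ⟨k, hk⟩ := h3
  have h4 : (d : ZMod n) = c * (Nat.gcdA c.val n : ZMod n) := by
    have := congrArg (Int.cast : ℤ → ZMod n) (Nat.gcd_eq_gcd_ab c.val n)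
    push_cast at this
    simpa using this
  refine ⟨(Nat.gcdA c.val n : ZMod n) * k, ?_⟩
  rw [← ZMod.natCast_zmod_val y, hk, Nat.cast_mul, h4]
  ring

theorem ZMod.baer_finsupp (n : ℕ) [NeZero n] (ι : Type*) :
    Module.Baer (ZMod n) (ι →₀ ZMod n) := by
  intro I g
  have : IsPrincipalIdealRing (ZMod n) :=
    IsPrincipalIdealRing.of_surjective (Int.castRingHom (ZMod n)) ZMod.intCast_surjective
  obtain ⟨c, rfl⟩ := IsPrincipalIdealRing.principal I
  have hc : c ∈ Submodule.span (ZMod n) {c} := Submodule.mem_span_singleton_self c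
  set y := g ⟨c, hc⟩ with hy
  have hann : ∀ z : ZMod n, z * c = 0 → z • y = 0 := by
    intro z hz
    rw [hy, ← map_smul]
    have : z • (⟨c, hc⟩ : Submodule.span (ZMod n) {c}) = 0 := Subtype.ext hz
    rw [this, map_zero]
  choose w hw using fun i => ZMod.exists_mul_eq_of_annihilator c (y i) fun z hz => by
    simpa using DFunLike.congr_fun (hann z hz) i
  classical
  -- The chosen `w i` may be nonzero where `y i = 0`; resetting it to `0` there keeps the support
  -- finite.
  let W : ι →₀ ZMod n := Finsupp.onFinset y.support (fun i => if y i = 0 then 0 else w i)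
    (fun i hi => by simpa using fun h => hi (if_pos h))
  have hW : c • W = y := by
    ext i
    by_cases h : y i = 0
    · simp [W, h]
    · simp [W, h, mul_comm c, hw]
  refine ⟨LinearMap.toSpanSingleton (ZMod n) _ W, fun x hx => ?_⟩
  obtain ⟨z, rfl⟩ := Submodule.mem_span_singleton.1 hx
  rw [LinearMap.toSpanSingleton_apply, smul_assoc, hW, hy, ← map_smul]
  rfl

/-- A group of exponent `n` is the product of a free `ZMod n`-module and a group of smaller
exponent. -/
theorem exists_addEquiv_finsupp_zmod_prod {R : Type u} [AddCommGroup R] {n : ℕ} [NeZero n]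
    (hn1 : n ≠ 1) [Module (ZMod n) R] :
    ∃ (I : Type u) (K : AddSubgroup R),
      Nonempty (R ≃+ (I →₀ ZMod n) × K) ∧ AddMonoid.exponent K ≠ n := by
  have : Nontrivial (ZMod n) := ZMod.nontrivial_iff.2 hn1
  obtain ⟨I, hI, hmax⟩ := exists_maximal_linearIndepOn' (ZMod n) (id : R → R)
  set L : (I →₀ ZMod n) →ₗ[ZMod n] R :=
    Finsupp.linearCombination (ZMod n) (fun x : I => (x : R)) with hLdef
  have hL : Function.Injective L := hI
  have hspan : Submodule.span (ZMod n) I = LinearMap.range L := by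
    rw [hLdef, Finsupp.range_linearCombination, Subtype.range_coe]
  obtain ⟨r, hr⟩ := (ZMod.baer_finsupp n I).extension_property L hL LinearMap.id
  have hrL : Function.LeftInverse r L := fun x => DFunLike.congr_fun hr x
  refine ⟨I, r.toAddMonoidHom.ker,
    ⟨AddEquiv.prodKerOfLeftInverse L.toAddMonoidHom r.toAddMonoidHom hrL⟩, fun heq => ?_⟩
  -- An element of order `n` in the complement would enlarge the maximal independent set `I`.
  obtain ⟨x, hx⟩ := AddMonoid.exists_addOrderOf_eq_exponent
    (AddMonoid.exponent_ne_zero.1 (heq ▸ NeZero.ne n))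
  rw [heq, ← AddSubgroup.addOrderOf_coe] at hx
  have hx0 : r (x : R) = 0 := x.2
  have hind : LinearIndepOn (ZMod n) id (I ∪ {(x : R)}) := by
    refine hI.id_union (LinearIndepOn.singleton' fun z hz => ?_) ?_
    · rw [← ZMod.natCast_zmod_val z, Nat.cast_smul_eq_nsmul] at hz
      rw [← ZMod.natCast_zmod_val z, ZMod.natCast_eq_zero_iff]
      exact hx.symm.dvd.trans (addOrderOf_dvd_of_nsmul_eq_zero hz)
    · rw [Submodule.disjoint_def]
      intro y hy hyx
      obtain ⟨z, rfl⟩ := Submodule.mem_span_singleton.1 hyx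
      obtain ⟨l, hl⟩ := hspan.le hy
      have hl0 : l = 0 := by
        rw [← hrL l]
        rw [hl, map_smul, hx0, smul_zero]
      rw [← hl, hl0, map_zero]
  have hxI : (x : R) ∈ I :=
    (hmax _ Set.subset_union_left hind).ge (Set.mem_union_right _ rfl)
  have h1 : L (Finsupp.single ⟨x, hxI⟩ 1) = x := by simp [L]
  have h2 := hrL (Finsupp.single ⟨x, hxI⟩ 1)
  rw [h1, hx0] at h2
  exact one_ne_zero (Finsupp.single_eq_zero.1 h2.symm)

/-- Induction on the exponent: split off a free `ZMod n`-summand, of finite rank by co-Hopficity,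
leaving a complement of smaller exponent. -/
theorem IsCoHopfian.finite_of_exponent_ne_zero {R : Type u} [AddCommGroup R]
    (hR : IsCoHopfian R) (hexp : AddMonoid.exponent R ≠ 0) : Finite R := by
  induction hn : AddMonoid.exponent R using Nat.strong_induction_on generalizing R with
  | _ n ih =>
  rw [hn] at hexp
  have : NeZero n := ⟨hexp⟩
  have hnR : ∀ x : R, n • x = 0 := fun x => hn ▸ AddMonoid.exponent_nsmul_eq_zero x
  rcases eq_or_ne n 1 with rfl | hn1
  · have : Subsingleton R := ⟨fun x y => by rw [← one_nsmul x, ← one_nsmul y, hnR, hnR]⟩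
    infer_instance
  have : Nontrivial (ZMod n) := ZMod.nontrivial_iff.2 hn1
  let _ : Module (ZMod n) R := AddCommGroup.zmodModule hnR
  obtain ⟨I, K, ⟨e⟩, hK⟩ := exists_addEquiv_finsupp_zmod_prod (R := R) hn1
  have hprod := hR.of_addEquiv e
  have : Finite I := hprod.fst.finite_of_finsupp
  have hdvd : AddMonoid.exponent K ∣ n :=
    AddMonoid.exponent_dvd_iff_forall_nsmul_eq_zero.2 fun x => Subtype.ext (hnR x)
  have : Finite K :=
    ih _ (lt_of_le_of_ne (Nat.le_of_dvd (Nat.pos_of_ne_zero hexp) hdvd) hK) hprod.snd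
      (fun h => hexp (zero_dvd_iff.1 (h ▸ hdvd))) rfl
  have : Finite (I →₀ ZMod n) := Finite.of_injective _ DFunLike.coe_injective
  exact Finite.of_equiv _ e.symm.toEquiv

/-! ### Quasi-cyclic groups -/

namespace QuasiCyclic

theorem exists_pow_nsmul_eq_zero {p : ℕ} (x : QuasiCyclic p) : ∃ k : ℕ, p ^ k • x = 0 := by
  obtain ⟨k, hk⟩ := (AddCommGroup.mem_primaryComponent).1 x.2
  exact ⟨k, Subtype.ext hk⟩

/-- The element `1/p` of `ℤ(p^∞)`. -/
noncomputable def gen (p : ℕ) [NeZero p] : QuasiCyclic p :=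
  ⟨((1 / p : ℚ) : AddCircle (1 : ℚ)), AddCommGroup.mem_primaryComponent.2 ⟨1, by
    have hp : (p : ℚ) ≠ 0 := NeZero.ne _
    rw [pow_one, ← AddCircle.coe_nsmul, AddCircle.coe_eq_zero_iff]
    exact ⟨1, by simp [hp]⟩⟩⟩

theorem coe_zsmul_gen (p : ℕ) [NeZero p] (m : ℤ) :
    ((m • gen p : QuasiCyclic p) : AddCircle (1 : ℚ)) = ((m / p : ℚ) : AddCircle (1 : ℚ)) := by
  change m • ((1 / p : ℚ) : AddCircle (1 : ℚ)) = _
  rw [← AddCircle.coe_zsmul, zsmul_eq_mul, mul_one_div]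

theorem zsmul_gen_eq_zero_iff {p : ℕ} [NeZero p] {m : ℤ} : m • gen p = 0 ↔ (p : ℤ) ∣ m := by
  have hp : (p : ℚ) ≠ 0 := NeZero.ne _
  rw [← ZeroMemClass.coe_eq_zero, coe_zsmul_gen, AddCircle.coe_eq_zero_iff]
  constructor
  · rintro ⟨n, hn⟩
    refine ⟨n, ?_⟩
    rw [zsmul_eq_mul, mul_one, eq_div_iff hp] at hn
    rw [mul_comm]
    exact_mod_cast hn.symm
  · rintro ⟨n, rfl⟩
    exact ⟨n, by simp [hp]⟩

theorem exists_eq_zsmul_gen {p : ℕ} [NeZero p] (x : QuasiCyclic p) (hx : p • x = 0) :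
    ∃ m : ℤ, x = m • gen p := by
  have hp : (p : ℚ) ≠ 0 := NeZero.ne _
  obtain ⟨x, hxm⟩ := x
  induction x using QuotientAddGroup.induction_on with
  | H r =>
    have h : p • ((r : ℚ) : AddCircle (1 : ℚ)) = 0 := congrArg Subtype.val hx
    rw [← AddCircle.coe_nsmul, AddCircle.coe_eq_zero_iff] at h
    obtain ⟨m, hm⟩ := h
    refine ⟨m, Subtype.ext ?_⟩
    rw [coe_zsmul_gen]
    change ((r : ℚ) : AddCircle (1 : ℚ)) = _
    congr 1
    rw [eq_div_iff hp]
    simpa [mul_comm] using hm.symm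

theorem eq_zero_of_nsmul_of_coprime {p n : ℕ} (h : Nat.Coprime n p) (x : QuasiCyclic p)
    (hx : n • x = 0) : x = 0 := by
  obtain ⟨k, hk⟩ := exists_pow_nsmul_eq_zero x
  rw [← AddMonoid.addOrderOf_eq_one_iff]
  exact Nat.eq_one_of_dvd_coprimes (h.pow_right k) (addOrderOf_dvd_of_nsmul_eq_zero hx)
    (addOrderOf_dvd_of_nsmul_eq_zero hk)

theorem exists_nsmul_eq {p q : ℕ} (hp : p.Prime) (hq : q.Prime) (x : QuasiCyclic p) :
    ∃ y, q • y = x := by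
  obtain ⟨k, hk⟩ := exists_pow_nsmul_eq_zero x
  rcases eq_or_ne q p with rfl | hqp
  · have hp0 : (q : ℚ) ≠ 0 := Nat.cast_ne_zero.2 hp.ne_zero
    obtain ⟨x, hxm⟩ := x
    induction x using QuotientAddGroup.induction_on with
    | H r =>
      have h : q • ((r / q : ℚ) : AddCircle (1 : ℚ)) = ((r : ℚ) : AddCircle (1 : ℚ)) := by
        rw [← AddCircle.coe_nsmul, nsmul_eq_mul, mul_div_cancel₀ _ hp0]
      refine ⟨⟨((r / q : ℚ) : AddCircle (1 : ℚ)),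
        AddCommGroup.mem_primaryComponent.2 ⟨k + 1, ?_⟩⟩, Subtype.ext h⟩
      rw [pow_succ, mul_smul, h]
      exact congrArg Subtype.val hk
  · have hc : Nat.Coprime q (p ^ k) := ((Nat.coprime_primes hq hp).2 hqp).pow_right k
    have hb := Nat.gcd_eq_gcd_ab q (p ^ k)
    rw [hc] at hb
    refine ⟨Nat.gcdA q (p ^ k) • x, ?_⟩
    have h2 : ((p ^ k : ℕ) : ℤ) • x = 0 := by rw [natCast_zsmul, hk]
    calc q • Nat.gcdA q (p ^ k) • x = ((q : ℤ) * Nat.gcdA q (p ^ k)) • x := by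
          rw [mul_smul, natCast_zsmul]
      _ = ((1 : ℕ) : ℤ) • x := by
          rw [hb, add_smul, mul_comm ((p ^ k : ℕ) : ℤ), mul_smul _ ((p ^ k : ℕ) : ℤ), h2, smul_zero,
            add_zero]
      _ = x := by simp

theorem finite_torsion (p : ℕ) {n : ℕ} (hn : n ≠ 0) : {x : QuasiCyclic p | n • x = 0}.Finite := by
  refine Set.Finite.of_finite_image (f := Subtype.val) ?_ Subtype.val_injective.injOn
  refine (AddCircle.finite_torsion (1 : ℚ) (Nat.pos_of_ne_zero hn)).subset ?_
  rintro _ ⟨x, hx, rfl⟩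
  exact congrArg Subtype.val hx

instance nontrivial (p : Nat.Primes) : Nontrivial (QuasiCyclic p) := by
  have : NeZero (p : ℕ) := ⟨p.2.ne_zero⟩
  refine ⟨gen p, 0, fun h => p.2.one_lt.ne' ?_⟩
  rw [← one_zsmul (gen p), zsmul_gen_eq_zero_iff] at h
  exact Nat.dvd_one.1 (by exact_mod_cast h)

theorem exists_hom {p : ℕ} [NeZero p] {D : Type*} [AddCommGroup D]
    (hD : Module.Baer ℤ D) (v : D) (hv : p • v = 0) : ∃ f : QuasiCyclic p →+ D, f (gen p) = v := by
  let i : ZMod p →+ QuasiCyclic p := ZMod.lift p ⟨zmultiplesHom _ (gen p), by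
    simpa using (zsmul_gen_eq_zero_iff (p := p) (m := p)).2 dvd_rfl⟩
  let g : ZMod p →+ D := ZMod.lift p ⟨zmultiplesHom _ v, by simpa using hv⟩
  have hi : Function.Injective i := by
    rw [ZMod.lift_injective]
    intro m hm
    rw [ZMod.intCast_zmod_eq_zero_iff_dvd]
    exact zsmul_gen_eq_zero_iff.1 hm
  obtain ⟨f, hf⟩ := hD.extension_property_addMonoidHom i hi g
  refine ⟨f, ?_⟩
  have h1 : i ((1 : ℤ) : ZMod p) = gen p := by simp only [i, ZMod.lift_coe]; simp
  have h2 : g ((1 : ℤ) : ZMod p) = v := by simp only [g, ZMod.lift_coe]; simp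
  rw [← h1, ← h2, ← hf]
  rfl

end QuasiCyclic

/-! ### Structure of divisible torsion groups -/

theorem AddMonoidHom.injective_of_torsion {A B : Type*} [AddCommGroup A] [AddCommGroup B]
    (φ : A →+ B) (hA : IsAddTorsion A)
    (h : ∀ q : ℕ, q.Prime → ∀ x : A, q • x = 0 → φ x = 0 → x = 0) : Function.Injective φ := by
  refine (injective_iff_map_eq_zero φ).2 fun x hx => ?_
  by_contra hx0
  have hpos : 0 < addOrderOf x := (hA x).addOrderOf_pos
  obtain ⟨q, hq, hqd⟩ := Nat.exists_prime_and_dvd (mt AddMonoid.addOrderOf_eq_one_iff.1 hx0)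
  have h1 : (addOrderOf x / q) • x = 0 := by
    refine h q hq _ ?_ (by rw [map_nsmul, hx, smul_zero])
    rw [smul_smul, Nat.mul_div_cancel' hqd, addOrderOf_nsmul_eq_zero]
  have h2 := Nat.le_of_dvd (Nat.div_pos (Nat.le_of_dvd hpos hqd) hq.pos)
    (addOrderOf_dvd_of_nsmul_eq_zero h1)
  exact absurd (Nat.div_lt_self hpos hq.one_lt) h2.not_gt

/-- If `q • y = φ z` and `z = q • w`, then `y - φ w` is killed by `q`; this drives an induction over
the prime factors of an annihilator of `y`. -/
theorem AddMonoidHom.surjective_of_torsion {A B : Type*} [AddCommGroup A] [AddCommGroup B]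
    (φ : A →+ B) (hB : IsAddTorsion B) (hA : ∀ q : ℕ, q.Prime → ∀ x : A, ∃ y, q • y = x)
    (h : ∀ q : ℕ, q.Prime → ∀ y : B, q • y = 0 → ∃ x, φ x = y) : Function.Surjective φ := by
  have key : ∀ N : ℕ, N ≠ 0 → ∀ y : B, N • y = 0 → ∃ x, φ x = y := by
    intro N
    induction N using induction_on_primes with
    | zero => exact fun h => absurd rfl h
    | one => exact fun _ y hy => ⟨0, by rw [map_zero, ← hy, one_nsmul]⟩
    | prime_mul q a hq ih =>
      intro hN y hy
      rw [mul_comm, mul_smul] at hy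
      obtain ⟨z, hz⟩ := ih (right_ne_zero_of_mul hN) _ hy
      obtain ⟨w, rfl⟩ := hA q hq z
      obtain ⟨x, hx⟩ := h q hq (y - φ w) (by rw [smul_sub, ← hz, map_nsmul, sub_self])
      exact ⟨x + w, by rw [map_add, hx, sub_add_cancel]⟩
  intro y
  obtain ⟨n, hn, hy⟩ := isOfFinAddOrder_iff_nsmul_eq_zero.1 (hB y)
  exact key n hn.ne' y hy

/-- A basis in integer coefficients, the form that matches multiples of `QuasiCyclic.gen p`. -/
theorem exists_generators_of_zmod_module (p : ℕ) [Fact p.Prime] (V : Type u) [AddCommGroup V]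
    [Module (ZMod p) V] : ∃ (I : Type u) (v : I → V),
      (∀ x, ∃ c : I →₀ ℤ, Finsupp.linearCombination ℤ v c = x) ∧
      ∀ c : I →₀ ℤ, Finsupp.linearCombination ℤ v c = 0 → ∀ i, (p : ℤ) ∣ c i := by
  let b := Module.Basis.ofVectorSpace (ZMod p) V
  have hb : ∀ c : _ →₀ ℤ, Finsupp.linearCombination ℤ b c =
      Finsupp.linearCombination (ZMod p) b (c.mapRange (Int.cast : ℤ → ZMod p) Int.cast_zero) := by
    intro c
    rw [Finsupp.linearCombination_apply, Finsupp.linearCombination_apply,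
      Finsupp.sum_mapRange_index (by simp)]
    simp only [Int.cast_smul_eq_zsmul]
  refine ⟨_, b, fun x => ?_, fun c hc i => ?_⟩
  · refine ⟨(b.repr x).mapRange (fun z => (z.val : ℤ)) (by simp), ?_⟩
    rw [hb]
    convert b.linearCombination_repr x
    ext i
    simp
  · rw [hb] at hc
    have := (linearIndependent_iff.1 b.linearIndependent) _ hc
    have := DFunLike.congr_fun this i
    rw [Finsupp.mapRange_apply] at this
    exact (ZMod.intCast_zmod_eq_zero_iff_dvd _ _).1 this

theorem exists_generators_of_prime_torsion (p : ℕ) [Fact p.Prime] (D : Type u) [AddCommGroup D] :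
    ∃ (I : Type u) (v : I → D), (∀ i, p • v i = 0) ∧
      (∀ x, p • x = 0 → ∃ c : I →₀ ℤ, Finsupp.linearCombination ℤ v c = x) ∧
      ∀ c : I →₀ ℤ, Finsupp.linearCombination ℤ v c = 0 → ∀ i, (p : ℤ) ∣ c i := by
  let V : AddSubgroup D := (nsmulAddMonoidHom p).ker
  let _ : Module (ZMod p) V := AddCommGroup.zmodModule (fun x => Subtype.ext x.2)
  obtain ⟨I, v, h1, h2⟩ := exists_generators_of_zmod_module p V
  have hv : ∀ c : I →₀ ℤ, Finsupp.linearCombination ℤ (fun i => (v i : D)) c =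
      (Finsupp.linearCombination ℤ v c : V) := by
    intro c
    simp [Finsupp.linearCombination_apply, Finsupp.sum]
  refine ⟨I, fun i => v i, fun i => (v i).2, fun x hx => ?_, fun c hc => h2 c ?_⟩
  · obtain ⟨c, hc⟩ := h1 ⟨x, hx⟩
    exact ⟨c, by rw [hv, hc]⟩
  · rw [hv] at hc
    exact Subtype.ext hc

theorem exists_nsmul_eq_directSum_finsupp {ι : Type*} [DecidableEq ι] {I : ι → Type*}
    {A : ι → Type*} [∀ i, AddCommGroup (A i)] (n : ℕ) (h : ∀ i, ∀ x : A i, ∃ y, n • y = x)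
    (x : ⨁ i, (I i →₀ A i)) : ∃ y, n • y = x := by
  change x ∈ (nsmulAddMonoidHom n).range
  induction x using DirectSum.induction_on with
  | zero => exact zero_mem _
  | add x y hx hy => exact add_mem hx hy
  | of i f =>
    induction f using Finsupp.induction_linear with
    | zero => rw [map_zero]; exact zero_mem _
    | add f g hf hg => rw [map_add]; exact add_mem hf hg
    | single j a =>
      obtain ⟨b, rfl⟩ := h i a
      exact ⟨DirectSum.of (fun i => I i →₀ A i) i (Finsupp.single j b), by simp [← map_nsmul]⟩

theorem isAddTorsion_directSum_finsupp {ι : Type*} [DecidableEq ι] {I : ι → Type*}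
    {A : ι → Type*} [∀ i, AddCommGroup (A i)] (h : ∀ i, IsAddTorsion (A i)) :
    IsAddTorsion (⨁ i, (I i →₀ A i)) := by
  intro x
  change x ∈ AddCommGroup.torsion _
  induction x using DirectSum.induction_on with
  | zero => exact zero_mem _
  | add x y hx hy => exact add_mem hx hy
  | of i f =>
    induction f using Finsupp.induction_linear with
    | zero => rw [map_zero]; exact zero_mem _
    | add f g hf hg => rw [map_add]; exact add_mem hf hg
    | single j a =>
      exact ((DirectSum.of (fun i => I i →₀ A i) i).comp
        (Finsupp.singleAddHom j)).isOfFinAddOrder (h i a)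

theorem QuasiCyclic.isAddTorsion (p : Nat.Primes) : IsAddTorsion (QuasiCyclic p) := by
  intro x
  obtain ⟨k, hk⟩ := QuasiCyclic.exists_pow_nsmul_eq_zero x
  exact isOfFinAddOrder_iff_nsmul_eq_zero.2 ⟨_, pow_pos p.2.pos k, hk⟩

/-- A divisible torsion group is a direct sum of quasi-cyclic groups. -/
theorem exists_addEquiv_directSum_quasiCyclic (D : Type u) [AddCommGroup D]
    (htor : IsAddTorsion D) (hdiv : ∀ n : ℕ, n ≠ 0 → ∀ x : D, ∃ y, n • y = x) :
    ∃ I : Nat.Primes → Type u,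
      Nonempty ((⨁ p : Nat.Primes, (I p →₀ QuasiCyclic p)) ≃+ D) := by
  have hne : ∀ p : Nat.Primes, NeZero (p : ℕ) := fun p => ⟨p.2.ne_zero⟩
  have hfact : ∀ p : Nat.Primes, Fact (p : ℕ).Prime := fun p => ⟨p.2⟩
  let _ : DivisibleBy D ℕ := divisibleByOfSMulRightSurj D ℕ fun {n} hn x => hdiv n hn x
  let _ : DivisibleBy D ℤ := AddGroup.divisibleByIntOfDivisibleByNat D
  have hB : Module.Baer ℤ D := Module.Baer.of_divisible D
  choose I v hv hspan hind using fun p : Nat.Primes => exists_generators_of_prime_torsion p D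
  choose f hf using fun (p : Nat.Primes) (i : I p) => QuasiCyclic.exists_hom hB (v p i) (hv p i)
  let g : ∀ p : Nat.Primes, (I p →₀ QuasiCyclic p) →+ D := fun p => Finsupp.liftAddHom (f p)
  let φ : (⨁ p : Nat.Primes, (I p →₀ QuasiCyclic p)) →+ D := DirectSum.toAddMonoid g
  have hφ : ∀ p x, φ (DirectSum.of (fun p : Nat.Primes => I p →₀ QuasiCyclic p) p x) = g p x :=
    fun p x => DirectSum.toAddMonoid_of g p x
  -- On elements killed by `p`, bijectivity thus reduces to `v p` being independent modulo `p` and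
  -- spanning.
  have hg : ∀ p (c : I p →₀ ℤ), g p (c.mapRange (fun z => z • QuasiCyclic.gen p) (zero_smul _ _)) =
      Finsupp.linearCombination ℤ (v p) c := by
    intro p c
    induction c using Finsupp.induction_linear with
    | zero => simp
    | add a b ha hb => rw [Finsupp.mapRange_add (fun _ _ => add_smul _ _ _), map_add, map_add, ha, hb]
    | single i z => simp [g, hf]
  refine ⟨I, ⟨AddEquiv.ofBijective φ ⟨?_, ?_⟩⟩⟩
  · refine φ.injective_of_torsion (isAddTorsion_directSum_finsupp fun p => QuasiCyclic.isAddTorsion p)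
      fun q hq x hqx hx => ?_
    obtain ⟨q, rfl⟩ : ∃ q' : Nat.Primes, (q' : ℕ) = q := ⟨⟨q, hq⟩, rfl⟩
    have hcoord : ∀ p i, (q : ℕ) • (x p i) = 0 := fun p i =>
      DFunLike.congr_fun (DFunLike.congr_fun hqx p) i
    choose c hc using fun i => QuasiCyclic.exists_eq_zsmul_gen (x q i) (hcoord q i)
    classical
    let C : I q →₀ ℤ := Finsupp.onFinset (x q).support (fun i => if x q i = 0 then 0 else c i)
      (fun i hi => by simpa using fun h => hi (if_pos h))
    have hC : C.mapRange (fun z => z • QuasiCyclic.gen q) (zero_smul _ _) = x q := by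
      ext1 i
      by_cases h : x q i = 0
      · simp [C, h]
      · simp only [C, Finsupp.mapRange_apply, Finsupp.onFinset_apply, if_neg h]
        exact (hc i).symm
    have hxq : x = DirectSum.of (fun p : Nat.Primes => I p →₀ QuasiCyclic p) q (x q) := by
      refine DFinsupp.ext fun p => ?_
      by_cases hpq : p = q
      · subst hpq
        rw [DirectSum.of_eq_same]
      · rw [DirectSum.of_eq_of_ne _ _ _ hpq]
        ext1 i
        exact QuasiCyclic.eq_zero_of_nsmul_of_coprime
          ((Nat.coprime_primes q.2 p.2).2 fun h => hpq (Subtype.ext h.symm)) _ (hcoord p i)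
    rw [hxq, hφ, ← hC, hg] at hx
    have hdvd := hind q C hx
    have h0 : x q = 0 := by
      rw [← hC]
      ext1 i
      simpa using QuasiCyclic.zsmul_gen_eq_zero_iff.2 (hdvd i)
    rw [hxq, h0, map_zero]
  · refine φ.surjective_of_torsion htor
      (fun q hq => exists_nsmul_eq_directSum_finsupp q fun p =>
        QuasiCyclic.exists_nsmul_eq p.2 hq) fun q hq y hy => ?_
    obtain ⟨q, rfl⟩ : ∃ q' : Nat.Primes, (q' : ℕ) = q := ⟨⟨q, hq⟩, rfl⟩
    obtain ⟨c, hc⟩ := hspan q y hy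
    exact ⟨_, (hφ q _).trans ((hg q c).trans hc)⟩

/-! ### Co-Hopfian groups: divisible torsion, torsion-free, torsion cotorsion -/

theorem IsCoHopfian.directSum_component {ι : Type*} [DecidableEq ι] {A : ι → Type*}
    [∀ i, AddCommGroup (A i)] (h : IsCoHopfian (⨁ i, A i)) (i : ι) : IsCoHopfian (A i) :=
  (h.of_addEquiv (AddEquiv.prodKerOfLeftInverse (DirectSum.of A i)
    (DirectSum.component ℤ ι A i).toAddMonoidHom fun x => DirectSum.of_eq_same i x)).fst

theorem IsCoHopfian.exists_addEquiv_of_divisible_torsion {D : Type u} [AddCommGroup D]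
    (hD : IsCoHopfian D) (htor : IsAddTorsion D)
    (hdiv : ∀ n : ℕ, n ≠ 0 → ∀ x : D, ∃ y, n • y = x) :
    ∃ k : Nat.Primes → ℕ, Nonempty (D ≃+ ⨁ p : Nat.Primes, (Fin (k p) → QuasiCyclic p)) := by
  obtain ⟨I, ⟨e⟩⟩ := exists_addEquiv_directSum_quasiCyclic D htor hdiv
  have hI : ∀ p, Finite (I p) := fun p =>
    ((hD.of_addEquiv e.symm).directSum_component p).finite_of_finsupp
  refine ⟨fun p => Nat.card (I p), ⟨e.symm.trans (DFinsupp.mapRange.addEquiv fun p => ?_)⟩⟩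
  exact (Finsupp.domCongr (Finite.equivFin (I p))).trans
    (Finsupp.linearEquivFunOnFinite ℤ (QuasiCyclic p) _).toAddEquiv

theorem IsCoHopfian.exists_nsmul_eq {F : Type*} [AddCommGroup F] [IsAddTorsionFree F]
    (hF : IsCoHopfian F) (n : ℕ) (hn : n ≠ 0) (x : F) : ∃ y, n • y = x :=
  (hF (nsmulAddMonoidHom n) (nsmul_right_injective hn)).2 x

/-- A torsion-free divisible group is a rational vector space. -/
theorem exists_addEquiv_finsupp_rat (F : Type u) [AddCommGroup F] [IsAddTorsionFree F]
    (hdiv : ∀ n : ℕ, n ≠ 0 → ∀ x : F, ∃ y, n • y = x) :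
    ∃ I : Type u, Nonempty (F ≃+ (I →₀ ℚ)) := by
  have hinj : ∀ s : nonZeroDivisors ℤ, Function.Injective fun x : F => (s : ℤ) • x :=
    fun s => zsmul_right_injective (nonZeroDivisors.coe_ne_zero s)
  have hsurj : ∀ s : nonZeroDivisors ℤ, Function.Surjective fun x : F => (s : ℤ) • x := by
    intro s x
    obtain ⟨y, hy⟩ := hdiv (s : ℤ).natAbs (Int.natAbs_ne_zero.2 (nonZeroDivisors.coe_ne_zero s)) x
    rcases Int.natAbs_eq (s : ℤ) with h | h
    · exact ⟨y, by dsimp only; rw [h, natCast_zsmul, hy]⟩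
    · exact ⟨-y, by dsimp only; rw [h, neg_smul_neg, natCast_zsmul, hy]⟩
  -- Nonzero integers act invertibly, so `F` is its own localization and inherits a rational
  -- structure.
  have : IsLocalizedModule (nonZeroDivisors ℤ) (LinearMap.id : F →ₗ[ℤ] F) := by
    refine ⟨fun s => ?_, fun y => ⟨(y, 1), by simp⟩, fun {x y} h => ⟨1, by simpa using h⟩⟩
    rw [Module.End.isUnit_iff]
    exact ⟨hinj s, hsurj s⟩
  let e := IsLocalizedModule.iso (nonZeroDivisors ℤ) (LinearMap.id : F →ₗ[ℤ] F)
  let e' : LocalizedModule (nonZeroDivisors ℤ) F ≃+ F := AddEquivClass.toAddEquiv e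
  let _ : Module ℚ (LocalizedModule (nonZeroDivisors ℤ) F) := Module.compHom _
    (IsLocalization.algEquiv (nonZeroDivisors ℤ) ℚ
      (Localization (nonZeroDivisors ℤ))).toRingEquiv.toRingHom
  let b := Module.Basis.ofVectorSpace ℚ (LocalizedModule (nonZeroDivisors ℤ) F)
  exact ⟨_, ⟨e'.symm.trans b.repr.toAddEquiv⟩⟩

theorem IsCoHopfian.exists_addEquiv_of_torsionFree {F : Type u} [AddCommGroup F]
    [IsAddTorsionFree F] (hF : IsCoHopfian F) : ∃ n : ℕ, Nonempty (F ≃+ (Fin n → ℚ)) := by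
  obtain ⟨I, ⟨e⟩⟩ := exists_addEquiv_finsupp_rat F hF.exists_nsmul_eq
  have : Finite I := (hF.of_addEquiv e).finite_of_finsupp
  exact ⟨Nat.card I, ⟨e.trans ((Finsupp.domCongr (Finite.equivFin I)).trans
    (Finsupp.linearEquivFunOnFinite ℤ ℚ _).toAddEquiv)⟩⟩

/-- A co-Hopfian torsion cotorsion group is the product of a divisible group and a finite group. -/
theorem IsCoHopfian.exists_addEquiv_of_cotorsion {T : Type u} [AddCommGroup T]
    (hT : IsCoHopfian T) (htor : IsAddTorsion T) (hcot : IsCotorsion T) :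
    ∃ (k : Nat.Primes → ℕ) (B : Type u) (_ : AddCommGroup B) (_ : Finite B),
      Nonempty (T ≃+ (⨁ p : Nat.Primes, (Fin (k p) → QuasiCyclic p)) × B) := by
  obtain ⟨M, hM, hdiv⟩ := hcot.exists_nsmul_divisible htor
  let D : AddSubgroup T := (nsmulAddMonoidHom M).range
  have hDdiv : ∀ n : ℕ, n ≠ 0 → ∀ x : D, ∃ y, n • y = x := by
    rintro n hn ⟨_, x, rfl⟩
    obtain ⟨y, hy⟩ := hdiv n hn x
    refine ⟨⟨M • y, y, rfl⟩, Subtype.ext ?_⟩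
    change n • M • y = M • x
    rw [hy, mul_smul]
  let _ : DivisibleBy D ℕ := divisibleByOfSMulRightSurj D ℕ fun {n} hn x => hDdiv n hn x
  let _ : DivisibleBy D ℤ := AddGroup.divisibleByIntOfDivisibleByNat D
  obtain ⟨r, hr⟩ := (Module.Baer.of_divisible D).extension_property_addMonoidHom D.subtype
    D.subtype_injective (AddMonoidHom.id D)
  have hrD : Function.LeftInverse r D.subtype := fun x => DFunLike.congr_fun hr x
  let e := AddEquiv.prodKerOfLeftInverse D.subtype r hrD
  have hprod := hT.of_addEquiv e
  obtain ⟨k, ⟨eD⟩⟩ := hprod.fst.exists_addEquiv_of_divisible_torsion (htor.addSubgroup D) hDdiv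
  -- `M • x` lies in `D`, where `r` is the identity, while `r x = 0`.
  have hker : ∀ x : r.ker, M • x = 0 := by
    rintro ⟨x, hx⟩
    have hx0 : r x = 0 := hx
    have h1 : r (M • x) = ⟨M • x, x, rfl⟩ := hrD ⟨M • x, x, rfl⟩
    rw [map_nsmul, hx0, smul_zero] at h1
    have h2 : M • x = 0 := congrArg Subtype.val h1.symm
    exact Subtype.ext h2
  have hfin : Finite r.ker := hprod.snd.finite_of_exponent_ne_zero fun h =>
    hM (zero_dvd_iff.1 (h ▸ AddMonoid.exponent_dvd_iff_forall_nsmul_eq_zero.2 hker))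
  exact ⟨k, r.ker, inferInstance, hfin, ⟨e.trans (eD.prodCongr (AddEquiv.refl _))⟩⟩

/-! ### The converse -/

/-- Only the finitely many primes dividing `m` contribute. -/
theorem finite_torsion_directSum_quasiCyclic (k : Nat.Primes → ℕ) {m : ℕ} (hm : m ≠ 0) :
    {x : ⨁ p : Nat.Primes, (Fin (k p) → QuasiCyclic p) | m • x = 0}.Finite := by
  let s : Set Nat.Primes := {p | (p : ℕ) ∣ m}
  have hs : s.Finite := Set.Finite.of_finite_image
    ((Nat.divisors m).finite_toSet.subset (by
      rintro _ ⟨p, hp, rfl⟩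
      exact Nat.mem_divisors.2 ⟨hp, hm⟩)) Subtype.val_injective.injOn
  have : Finite s := hs
  let F : (⨁ p : Nat.Primes, (Fin (k p) → QuasiCyclic p)) → ∀ p : s, Fin (k p) → QuasiCyclic p :=
    fun x p => x p
  refine Set.Finite.of_finite_image (f := F) ?_ ?_
  · refine (Set.Finite.pi' fun p : s => Set.Finite.pi' fun _ : Fin (k p) =>
      QuasiCyclic.finite_torsion (p : Nat.Primes) hm).subset ?_
    rintro _ ⟨x, hx, rfl⟩ p i
    exact congrFun (DFunLike.congr_fun (show m • x = 0 from hx) (p : Nat.Primes)) i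
  · intro x hx y hy hxy
    refine DFinsupp.ext fun p => ?_
    by_cases hp : (p : ℕ) ∣ m
    · exact congrFun hxy ⟨p, hp⟩
    · have h0 : ∀ z : ⨁ p : Nat.Primes, (Fin (k p) → QuasiCyclic p), m • z = 0 → z p = 0 := by
        intro z hz
        ext1 i
        exact QuasiCyclic.eq_zero_of_nsmul_of_coprime
          ((Nat.Prime.coprime_iff_not_dvd p.2).2 hp).symm _
          (congrFun (DFunLike.congr_fun hz p) i)
      exact (h0 x hx).trans (h0 y hy).symm

/-- A torsion group all of whose `m`-torsion subgroups are finite stays co-Hopfian after adding a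
finite-dimensional rational vector space. -/
theorem isCoHopfian_rat_prod (n : ℕ) {T : Type*} [AddCommGroup T] (htor : IsAddTorsion T)
    (hfin : ∀ m : ℕ, m ≠ 0 → {x : T | m • x = 0}.Finite) :
    IsCoHopfian ((Fin n → ℚ) × T) := by
  intro f hf
  have htf : ∀ (m : ℕ) (v : Fin n → ℚ), m ≠ 0 → m • v = 0 → v = 0 := by
    intro m v hm hv
    ext i
    simpa [hm] using congrFun hv i
  have hT : ∀ t : T, ∃ x, f x = (0, t) := by
    intro t
    obtain ⟨m, hm, hmt⟩ := isOfFinAddOrder_iff_nsmul_eq_zero.1 (htor t)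
    have hfin' : {x : (Fin n → ℚ) × T | m • x = 0}.Finite := by
      refine ((Set.finite_singleton (0 : Fin n → ℚ)).prod (hfin m hm.ne')).subset ?_
      intro x hx
      exact ⟨htf m _ hm.ne' (congrArg Prod.fst hx), congrArg Prod.snd hx⟩
    have hmaps : Set.MapsTo f {x | m • x = 0} {x | m • x = 0} := by
      intro x hx
      change m • f x = 0
      rw [← map_nsmul, show m • x = 0 from hx, map_zero]
    obtain ⟨x, -, hx⟩ := ((hfin'.injOn_iff_bijOn_of_mapsTo hmaps).1 hf.injOn).surjOn
      (show m • ((0 : Fin n → ℚ), t) = 0 by ext1 <;> simp [hmt])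
    exact ⟨x, hx⟩
  let g : (Fin n → ℚ) →+ (Fin n → ℚ) :=
    ((AddMonoidHom.fst _ _).comp f).comp (AddMonoidHom.inl _ _)
  -- If `f (v, 0)` has zero rational part it is torsion, so injectivity of `f` makes `v` torsion,
  -- hence zero.
  have hg : Function.Injective g.toRatLinearMap := by
    refine (injective_iff_map_eq_zero g).2 fun v hv => ?_
    have hv' : (f (v, 0)).1 = 0 := hv
    obtain ⟨m, hm, hmt⟩ := isOfFinAddOrder_iff_nsmul_eq_zero.1 (htor (f (v, 0)).2)
    have h0 : f (m • (v, 0)) = 0 := by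
      rw [map_nsmul]
      ext1
      · simp [hv']
      · simpa using hmt
    exact htf m v hm.ne' (congrArg Prod.fst ((injective_iff_map_eq_zero f).1 hf _ h0))
  have hgs : Function.Surjective g.toRatLinearMap := LinearMap.surjective_of_injective hg
  refine ⟨hf, fun y => ?_⟩
  obtain ⟨v, hv⟩ := hgs y.1
  have hv' : (f (v, 0)).1 = y.1 := hv
  obtain ⟨x, hx⟩ := hT (y.2 - (f (v, 0)).2)
  refine ⟨(v, 0) + x, ?_⟩
  rw [map_add, hx]
  ext1 <;> simp [hv']

theorem isCoHopfian_rat_prod_quasiCyclic_prod (n : ℕ) (k : Nat.Primes → ℕ) (B : Type*)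
    [AddCommGroup B] [Finite B] :
    IsCoHopfian ((Fin n → ℚ) × (⨁ p : Nat.Primes, (Fin (k p) → QuasiCyclic p)) × B) := by
  have hQ : IsAddTorsion (⨁ p : Nat.Primes, (Fin (k p) → QuasiCyclic p)) := by
    let e : (⨁ p : Nat.Primes, (Fin (k p) →₀ QuasiCyclic p)) ≃+
        ⨁ p : Nat.Primes, (Fin (k p) → QuasiCyclic p) :=
      DFinsupp.mapRange.addEquiv fun p =>
        (Finsupp.linearEquivFunOnFinite ℤ (QuasiCyclic p) _).toAddEquiv
    exact (isAddTorsion_directSum_finsupp QuasiCyclic.isAddTorsion).of_surjective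
      (f := e.toAddMonoidHom) e.surjective
  refine isCoHopfian_rat_prod n ?_ fun m hm => ?_
  · exact fun x => IsOfFinAddOrder.prod_mk (hQ x.1) (isOfFinAddOrder_of_finite x.2)
  · refine ((finite_torsion_directSum_quasiCyclic k hm).prod (Set.toFinite Set.univ)).subset ?_
    exact fun x hx => ⟨congrArg Prod.fst hx, trivial⟩

/-! ### The characterization -/

theorem corollary5p5 (G : Type u) [AddCommGroup G]
    (hG : IsCotorsion (AddCommGroup.torsion G)) :
    IsCoHopfian G ↔
      ∃ (n : ℕ) (k : Nat.Primes → ℕ) (B : Type u) (_ : AddCommGroup B) (_ : Finite B),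
        Nonempty (G ≃+
          (Fin n → ℚ) × (⨁ p : Nat.Primes, (Fin (k p) → QuasiCyclic p)) × B) := by
  constructor
  · intro h
    let T := AddCommGroup.torsion G
    have hmem : ∀ (n : ℕ) (e : G), n ≠ 0 → n • e ∈ T → e ∈ T := fun n e hn he =>
      IsOfFinAddOrder.of_nsmul he hn
    obtain ⟨r, hr⟩ := hG.exists_leftInverse T.subtype T.subtype_injective (by simpa using hmem)
    let e := AddEquiv.prodKerOfLeftInverse T.subtype r hr
    have hprod := h.of_addEquiv e
    have : IsAddTorsionFree r.ker := by
      refine ⟨fun n hn => (injective_iff_map_eq_zero (nsmulAddMonoidHom (α := r.ker) n)).2 ?_⟩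
      rintro ⟨x, hx⟩ hnx
      have hxT : x ∈ T := hmem n x hn (by
        rw [show n • x = 0 from congrArg Subtype.val hnx]; exact zero_mem _)
      have h1 : r x = ⟨x, hxT⟩ := hr ⟨x, hxT⟩
      rw [show r x = 0 from hx] at h1
      have h2 : x = 0 := congrArg Subtype.val h1.symm
      exact Subtype.ext h2
    obtain ⟨n, ⟨eF⟩⟩ := hprod.snd.exists_addEquiv_of_torsionFree
    obtain ⟨k, B, hB, hfin, ⟨eT⟩⟩ := hprod.fst.exists_addEquiv_of_cotorsion
      AddCommMonoid.addTorsion.isAddTorsion hG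
    exact ⟨n, k, B, hB, hfin, ⟨e.trans (AddEquiv.prodComm.trans (eF.prodCongr eT))⟩⟩
  · rintro ⟨n, k, B, _, _, ⟨e⟩⟩
    exact (isCoHopfian_rat_prod_quasiCyclic_prod n k B).of_addEquiv e.symm
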